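/- Let $p\in(0,1)$ be fixed. For each $n$ let $G_n(p)$ be the random simple graph on the vertex set $\{1,\dots,n\}$ in which each of the $\binom n2$ possible edges is present independently with probability $p$. The energy $\mathcal{E}(G)$ of a finite simple graph $G$ is the sum of the absolute values of the eigenvalues (with multiplicity) of its adjacency matrix. Then almost every random graph $G_n(p)$ satisfies $$\mathcal{E}(G_n(p)) = n^{3/2}\left(\frac{8}{3\pi}\sqrt{p(1-p)}+o(1)\right),$$ that is, there is a deterministic sequence $\varepsilon_n\to 0$ such that $$\Pr\left[\,\mathcal{E}(G_n(p)) = n^{3/2}\left(\tfrac{8}{3\pi}\sqrt{p(1-p)}+\delta\right)\text{ for some real }\delta\text{ with }|\delta|\le\varepsilon_n\right]\longrightarrow 1\qquad(n\to\infty).$$ -/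

import Mathlib

open Filter Topology

namespace SimpleGraph

open scoped Classical in
/-- The energy of a finite simple graph: the sum of the absolute values of the eigenvalues,
counted with multiplicity, of its (real) adjacency matrix. -/
noncomputable def graphEnergy {V : Type*} [Fintype V] [DecidableEq V] (G : SimpleGraph V) : ℝ :=
  ∑ i, |(G.isHermitian_adjMatrix (R := ℝ)).eigenvalues i|

/-- Almost every graph in the binomial (Erdős–Rényi) model `G_n(p)` has the property `Q`:
the probability that the random graph on `n` labelled vertices, whose edges are chosen
independently with probability `p`, has the property tends to `1` as `n → ∞`. -/
def AlmostEveryGnp (p : unitInterval) (Q : (n : ℕ) → SimpleGraph (Fin n) → Prop) : Prop :=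
  Tendsto (fun n : ℕ ↦ binomialRandom (Fin n) p {G | Q n G}) atTop (𝓝 1)

end SimpleGraph

/-! Scale the adjacency matrix A by a = n^(-1/2). Since |x| = (2/π) ∫ x²/(x²+t²) dt over t > 0
(`integral_sq_div_sq_add_sq`), the normalised energy is (2/π) ∫ `coulsonSum`, and `coulsonSum` is 1
- t Im s, where s = n⁻¹ tr R and R = (aA - it)⁻¹. Only resolvents on the imaginary axis are needed.

The core is `gnpExp_sq_norm_quadDefect_le`: with v = p(1-p), the defect Q = v s² + i t s + 1
satisfies E|Q|² = O_t(a). In E[Q conj Q] the first factor is written as v s² plus an edge sum of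
resolvent entries, and each edge indicator is integrated by parts. Switching ij changes R_ji by
about -a(R_ji² + R_jj R_ii); the second product sums to a term cancelling v s². Keeping conj Q
inside the expectation replaces a separate concentration argument. A is never centred: its mean
contributes p ∑ R_ij, at most n/t in norm.

The semicircle value iy is a stable root of the quadratic (`mul_norm_sub_semicircleStieltjes_le`),
so `coulsonSum` tends in mean to v y², whose integral is (4/3)√v. Domination by 2/(1+t²), from tr A²
≤ n², passes the limit through the integral, and Markov's inequality concludes. -/

namespace Matrix

/-! ### Operator norm bounds and resolvents on the imaginary axis. -/

open scoped Matrix.Norms.L2Operator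

variable {V : Type*} [Fintype V] [DecidableEq V]

/-- A sesquilinear form is bounded by the operator norm of its matrix. -/
lemma norm_star_dotProduct_mulVec_le (B : Matrix V V ℂ) (x y : V → ℂ) :
    ‖star x ⬝ᵥ (B *ᵥ y)‖ ≤ ‖B‖ * ‖WithLp.toLp 2 x‖ * ‖WithLp.toLp 2 y‖ := by
  have h : star x ⬝ᵥ (B *ᵥ y) = inner ℂ (WithLp.toLp 2 x) (WithLp.toLp 2 (B *ᵥ y)) := by
    rw [EuclideanSpace.inner_toLp_toLp, dotProduct_comm]
  rw [h]
  calc _ ≤ ‖WithLp.toLp 2 x‖ * ‖WithLp.toLp 2 (B *ᵥ y)‖ := norm_inner_le_norm _ _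
    _ ≤ ‖WithLp.toLp 2 x‖ * (‖B‖ * ‖WithLp.toLp 2 y‖) := by
      gcongr
      exact l2_opNorm_mulVec B (WithLp.toLp 2 y)
    _ = _ := by ring

lemma norm_apply_le_l2_opNorm (B : Matrix V V ℂ) (i j : V) : ‖B i j‖ ≤ ‖B‖ := by
  have h := norm_star_dotProduct_mulVec_le B (Pi.single i 1) (Pi.single j 1)
  simpa [← Pi.single_star, single_dotProduct] using h

lemma norm_trace_le (B : Matrix V V ℂ) : ‖B.trace‖ ≤ Fintype.card V * ‖B‖ := by
  calc ‖B.trace‖ ≤ ∑ i, ‖B i i‖ := norm_sum_le _ _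
    _ ≤ ∑ _i : V, ‖B‖ := Finset.sum_le_sum fun i _ ↦ norm_apply_le_l2_opNorm B i i
    _ = _ := by simp

/-- Testing against the all-ones vector gives a bound linear, not quadratic, in the dimension; this
is what makes centring the adjacency matrix unnecessary. -/
lemma norm_sum_sum_apply_le (B : Matrix V V ℂ) :
    ‖∑ i, ∑ j, B i j‖ ≤ Fintype.card V * ‖B‖ := by
  have h := norm_star_dotProduct_mulVec_le B 1 1
  have h1 : ‖WithLp.toLp 2 (1 : V → ℂ)‖ * ‖WithLp.toLp 2 (1 : V → ℂ)‖ = Fintype.card V := by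
    rw [← sq, EuclideanSpace.norm_sq_eq]
    simp
  have h2 : star (1 : V → ℂ) ⬝ᵥ (B *ᵥ 1) = ∑ i, ∑ j, B i j := by
    simp [dotProduct, mulVec]
  rw [h2, mul_assoc, h1] at h
  linarith

/-- The symmetric elementary matrix `E_ij + E_ji`. -/
def symmSingle (i j : V) : Matrix V V ℂ := single i j 1 + single j i 1

lemma norm_single_le (i j : V) : ‖(single i j 1 : Matrix V V ℂ)‖ ≤ 1 := by
  have h := l2_opNorm_conjTranspose_mul_self (single i j 1 : Matrix V V ℂ)
  rw [conjTranspose_single, single_mul_single_same] at h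
  simp only [star_one, mul_one] at h
  rw [← diagonal_single, l2_opNorm_diagonal, Pi.norm_single] at h
  simp only [norm_one] at h
  nlinarith [norm_nonneg (single i j 1 : Matrix V V ℂ)]

lemma norm_symmSingle_le (i j : V) : ‖symmSingle i j‖ ≤ 2 :=
  (norm_add_le _ _).trans (by linarith [norm_single_le i j, norm_single_le j i])

lemma mul_symmSingle_mul_apply (B C : Matrix V V ℂ) (i j k l : V) :
    (B * symmSingle i j * C) k l = B k i * C j l + B k j * C i l := by
  simp [symmSingle, mul_add, add_mul, mul_apply, single_apply, ite_and, Finset.sum_add_distrib]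

/-- Cyclicity reduces the trace to two entries of `C * B`, so no factor of the dimension appears. -/
lemma norm_trace_mul_symmSingle_mul_le (B C : Matrix V V ℂ) (i j : V) :
    ‖(B * symmSingle i j * C).trace‖ ≤ 2 * (‖B‖ * ‖C‖) := by
  have h : (B * symmSingle i j * C).trace = (C * B) j i + (C * B) i j := by
    rw [trace_mul_comm, ← mul_assoc]
    simp [symmSingle, mul_add, trace_mul_single, add_comm]
  rw [h]
  have := norm_apply_le_l2_opNorm (C * B) j i
  have := norm_apply_le_l2_opNorm (C * B) i j
  have := norm_mul_le C B
  have := norm_add_le ((C * B) j i) ((C * B) i j)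
  linarith [mul_comm ‖B‖ ‖C‖]

/-- The resolvent of a real matrix at the purely imaginary point `t * I`. -/
noncomputable def imResolvent (M : Matrix V V ℝ) (t : ℝ) : Matrix V V ℂ :=
  (M.map (↑) - (t * Complex.I) • 1)⁻¹

lemma ofReal_sub_mul_I_ne_zero (x : ℝ) {t : ℝ} (ht : t ≠ 0) : (x : ℂ) - t * Complex.I ≠ 0 := by
  intro h
  have := congrArg Complex.im h
  simp at this
  exact ht this

/-- The resolvent of a multiple of a symmetric matrix in an eigenbasis of the matrix. -/
lemma IsHermitian.exists_imResolvent_smul_eq {M : Matrix V V ℝ} (hM : M.IsHermitian) (a : ℝ)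
    {t : ℝ} (ht : t ≠ 0) :
    ∃ U : Matrix V V ℂ, U * star U = 1 ∧ star U * U = 1 ∧
      (a • M).map (↑) - (t * Complex.I) • 1 =
        U * diagonal (fun i ↦ ((a * hM.eigenvalues i : ℝ) : ℂ) - t * Complex.I) * star U ∧
      imResolvent (a • M) t =
        U * diagonal (fun i ↦ (((a * hM.eigenvalues i : ℝ) : ℂ) - t * Complex.I)⁻¹) * star U := by
  let W : Matrix V V ℝ := hM.eigenvectorUnitary
  let U : Matrix V V ℂ := W.map Complex.ofRealHom
  have hW1 : W * star W = 1 := Unitary.mul_star_self_of_mem hM.eigenvectorUnitary.2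
  have hW2 : star W * W = 1 := Unitary.star_mul_self_of_mem hM.eigenvectorUnitary.2
  have hstar : star U = (star W).map Complex.ofRealHom := by
    ext i j
    simp [U, star_apply]
  have hU1 : U * star U = 1 := by
    rw [hstar, ← Matrix.map_mul, hW1]
    simp
  have hU2 : star U * U = 1 := by
    rw [hstar, ← Matrix.map_mul, hW2]
    simp
  have hspec : a • M = W * diagonal (fun i ↦ a * hM.eigenvalues i) * star W := by
    conv_lhs => rw [hM.spectral_theorem, Unitary.conjStarAlgAut_apply]
    rw [← smul_mul_assoc, ← mul_smul_comm, ← diagonal_smul]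
    rfl
  have hdiag : (a • M).map (↑) - (t * Complex.I) • 1 =
      U * diagonal (fun i ↦ ((a * hM.eigenvalues i : ℝ) : ℂ) - t * Complex.I) * star U := by
    have h1 : (a • M).map ((↑) : ℝ → ℂ) =
        U * diagonal (fun i ↦ ((a * hM.eigenvalues i : ℝ) : ℂ)) * star U := by
      rw [hspec, hstar]
      change (W * diagonal (fun i ↦ a * hM.eigenvalues i) * star W).map Complex.ofRealHom = _
      rw [Matrix.map_mul, Matrix.map_mul, diagonal_map (by simp)]
      rfl
    have h2 : ((t * Complex.I : ℂ) • 1 : Matrix V V ℂ) =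
        U * diagonal (fun _ ↦ (t * Complex.I : ℂ)) * star U := by
      rw [← smul_one_eq_diagonal, mul_smul_comm, mul_one, smul_mul_assoc, hU1]
    rw [h1, h2, ← sub_mul, ← mul_sub, diagonal_sub]
  refine ⟨U, hU1, hU2, hdiag, ?_⟩
  rw [imResolvent, hdiag]
  refine inv_eq_right_inv ?_
  calc _ = U * (diagonal (fun i ↦ ((a * hM.eigenvalues i : ℝ) : ℂ) - t * Complex.I) *
        (star U * U) *
        diagonal (fun i ↦ (((a * hM.eigenvalues i : ℝ) : ℂ) - t * Complex.I)⁻¹)) * star U := by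
        simp only [Matrix.mul_assoc]
    _ = 1 := by
        rw [hU2, mul_one, diagonal_mul_diagonal]
        simp only [mul_inv_cancel₀ (ofReal_sub_mul_I_ne_zero _ ht), diagonal_one, mul_one, hU1]

section Resolvent

variable {M : Matrix V V ℝ} {t : ℝ}

lemma IsHermitian.mul_imResolvent (hM : M.IsHermitian) (ht : t ≠ 0) :
    (M.map (↑) - (t * Complex.I) • 1) * imResolvent M t = 1 := by
  obtain ⟨U, hU1, hU2, h1, h2⟩ := hM.exists_imResolvent_smul_eq 1 ht
  rw [one_smul] at h1 h2
  rw [imResolvent, mul_nonsing_inv]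
  rw [h1, det_mul, det_mul, mul_right_comm, ← det_mul, hU1, det_one, one_mul, det_diagonal]
  exact (Finset.prod_ne_zero_iff.2 fun i _ ↦ ofReal_sub_mul_I_ne_zero _ ht).isUnit

lemma IsHermitian.imResolvent_mul (hM : M.IsHermitian) (ht : t ≠ 0) :
    imResolvent M t * (M.map (↑) - (t * Complex.I) • 1) = 1 :=
  mul_eq_one_comm.1 (hM.mul_imResolvent ht)

lemma IsHermitian.map_mul_imResolvent (hM : M.IsHermitian) (ht : t ≠ 0) :
    M.map (↑) * imResolvent M t = 1 + (t * Complex.I) • imResolvent M t := by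
  have h := hM.mul_imResolvent ht
  rw [sub_mul, smul_mul_assoc, one_mul] at h
  rw [← h, sub_add_cancel]

lemma IsHermitian.norm_imResolvent_le (hM : M.IsHermitian) (ht : 0 < t) :
    ‖imResolvent M t‖ ≤ t⁻¹ := by
  obtain ⟨U, hU1, hU2, -, h2⟩ := hM.exists_imResolvent_smul_eq 1 ht.ne'
  rw [one_smul] at h2
  have hmem : U ∈ unitary (Matrix V V ℂ) := Unitary.mem_iff.2 ⟨hU2, hU1⟩
  rw [h2, CStarRing.norm_mul_mem_unitary _ (Unitary.star_mem hmem),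
    CStarRing.norm_mem_unitary_mul _ hmem, l2_opNorm_diagonal]
  refine (pi_norm_le_iff_of_nonneg (by positivity)).2 fun i ↦ ?_
  rw [norm_inv]
  refine inv_anti₀ ht ?_
  have := Complex.abs_im_le_norm (((1 * hM.eigenvalues i : ℝ) : ℂ) - t * Complex.I)
  simpa [abs_of_pos ht] using this

lemma IsHermitian.imResolvent_transpose (hM : M.IsHermitian) :
    (imResolvent M t)ᵀ = imResolvent M t := by
  rw [imResolvent, transpose_nonsing_inv]
  congr 1
  have : Mᵀ = M := by simpa [IsHermitian] using hM
  rw [transpose_sub, ← transpose_map, this]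
  simp

lemma IsHermitian.trace_imResolvent_smul (hM : M.IsHermitian) (a : ℝ) (ht : t ≠ 0) :
    (imResolvent (a • M) t).trace =
      ∑ i, (((a * hM.eigenvalues i : ℝ) : ℂ) - t * Complex.I)⁻¹ := by
  obtain ⟨U, hU1, hU2, -, h2⟩ := hM.exists_imResolvent_smul_eq a ht
  rw [h2, trace_mul_comm, ← mul_assoc, hU2, one_mul, trace_diagonal]

/-- The resolvent identity. -/
lemma IsHermitian.imResolvent_sub {N : Matrix V V ℝ} (hM : M.IsHermitian) (hN : N.IsHermitian)
    (ht : t ≠ 0) :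
    imResolvent M t - imResolvent N t =
      imResolvent M t * (N.map (↑) - M.map (↑)) * imResolvent N t := by
  have h : (N.map (↑) - M.map (↑) : Matrix V V ℂ) =
      (N.map (↑) - (t * Complex.I) • 1) - (M.map (↑) - (t * Complex.I) • 1) := by abel
  rw [h, mul_sub, sub_mul, mul_assoc, hN.mul_imResolvent ht, hM.imResolvent_mul ht]
  simp

end Resolvent

end Matrix

/-! ### Switching an edge, and expectations over the binomial random graph. -/

namespace SimpleGraph

open MeasureTheory

section Toggle

variable {V : Type*} {i j : V}

lemma adj_sup_edge (G : SimpleGraph V) (hij : i ≠ j) : (G ⊔ edge i j).Adj i j := by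
  simp [edge_adj, hij]

lemma not_adj_sdiff_edge (G : SimpleGraph V) : ¬ (G \ edge i j).Adj i j := by
  simp only [sdiff_adj, edge_adj]
  rintro ⟨h, h'⟩
  exact h' ⟨Or.inl ⟨trivial, trivial⟩, h.ne⟩

lemma sup_edge_sdiff_edge {G : SimpleGraph V} (h : ¬ G.Adj i j) :
    (G ⊔ edge i j) \ edge i j = G := by
  rw [sup_sdiff_right_self, sdiff_edge _ h]

lemma sdiff_edge_sup_edge {G : SimpleGraph V} (h : G.Adj i j) :
    G \ edge i j ⊔ edge i j = G := by
  rw [sdiff_sup_self, sup_edge_of_adj _ h]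

end Toggle

lemma measurableSingletonClass_simpleGraph {V : Type*} [Fintype V] :
    MeasurableSingletonClass (SimpleGraph V) where
  measurableSet_singleton G := by
    have : ({G} : Set (SimpleGraph V)) = edgeSet ⁻¹' {G.edgeSet} := by
      ext G'
      simp
    rw [this]
    exact measurable_edgeSet (MeasurableSet.singleton _)

lemma binomialRandom_real_singleton {V : Type*} [Finite V] {p : unitInterval}
    (G : SimpleGraph V) :
    (binomialRandom V p).real {G} = (p : ℝ) ^ G.edgeSet.ncard *
      (1 - (p : ℝ)) ^ ((Nat.card V).choose 2 - G.edgeSet.ncard) := by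
  simp [measureReal_def]

section Expectation

variable {V : Type*} [Fintype V] [DecidableEq V] (p : unitInterval) {i j : V}

/-- The expectation of a function of the binomial random graph, as a finite sum. -/
noncomputable def gnpExp {E : Type*} [AddCommGroup E] [Module ℝ E]
    (F : SimpleGraph V → E) : E :=
  ∑ G, (binomialRandom V p).real {G} • F G

variable {p}

/-- Adding an edge trades one factor 1 - p of the weight for a factor p. -/
lemma mul_binomialRandom_real_singleton (hij : i ≠ j) {G : SimpleGraph V} (h : ¬ G.Adj i j) :
    (p : ℝ) * (binomialRandom V p).real {G} =
      (1 - (p : ℝ)) * (binomialRandom V p).real {G ⊔ edge i j} := by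
  classical
  have hc : (G ⊔ edge i j).edgeSet.ncard = G.edgeSet.ncard + 1 := by
    rw [edgeSet_sup, edgeSet_edge_of_ne hij, Set.union_singleton,
      Set.ncard_insert_of_notMem (by simpa using h) (Set.toFinite _)]
  have hle : (G ⊔ edge i j).edgeSet.ncard ≤ (Nat.card V).choose 2 := by
    rw [← coe_edgeFinset, Set.ncard_coe_finset, Nat.card_eq_fintype_card]
    exact card_edgeFinset_le_card_choose_two
  rw [binomialRandom_real_singleton, binomialRandom_real_singleton, hc]
  rw [hc] at hle
  -- The edge count bound ensures that the natural subtractions in the exponents do not truncate.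
  obtain ⟨m, hm⟩ := Nat.exists_eq_add_of_le hle
  have h1 : (Nat.card V).choose 2 - G.edgeSet.ncard = m + 1 := by omega
  have h2 : (Nat.card V).choose 2 - (G.edgeSet.ncard + 1) = m := by omega
  rw [h1, h2]
  ring

lemma sum_binomialRandom_real_singleton : ∑ G, (binomialRandom V p).real {G} = 1 := by
  have : MeasurableSingletonClass (SimpleGraph V) := measurableSingletonClass_simpleGraph
  rw [sum_measureReal_singleton]
  simp

variable {E : Type*} [AddCommGroup E] [Module ℝ E]

open scoped Classical in
/-- Switching an edge on and off exchanges the graphs that contain it and those that do not. -/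
lemma sum_filter_not_adj_eq {E : Type*} [AddCommMonoid E] (hij : i ≠ j)
    (f : SimpleGraph V → E) :
    ∑ G with ¬ G.Adj i j, f (G ⊔ edge i j) = ∑ G with G.Adj i j, f G := by
  refine Finset.sum_bij' (fun G _ ↦ G ⊔ edge i j) (fun G _ ↦ G \ edge i j) ?_ ?_ ?_ ?_ ?_
  · intro G _
    simpa using adj_sup_edge G hij
  · intro G _
    simpa using not_adj_sdiff_edge G
  · intro G hG
    exact sup_edge_sdiff_edge (by simpa using hG)
  · intro G hG
    exact sdiff_edge_sup_edge (by simpa using hG)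
  · intros
    rfl

open scoped Classical in
-- The weight exchange moves the graphs without ij onto those with ij, where the coefficients p and
-- 1 - p add up to 1.
lemma smul_gnpExp_sup_edge (hij : i ≠ j) (F : SimpleGraph V → E) :
    (p : ℝ) • gnpExp p (fun G ↦ F (G ⊔ edge i j)) =
      gnpExp p (fun G ↦ if G.Adj i j then F G else 0) := by
  have h1 : (p : ℝ) • gnpExp p (fun G ↦ F (G ⊔ edge i j)) =
      ∑ G with G.Adj i j, ((p : ℝ) * (binomialRandom V p).real {G}) • F G +
      ∑ G with ¬ G.Adj i j, ((1 - (p : ℝ)) * (binomialRandom V p).real {G ⊔ edge i j}) •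
        F (G ⊔ edge i j) := by
    rw [gnpExp, Finset.smul_sum, ← Finset.sum_filter_add_sum_filter_not _ (fun G ↦ G.Adj i j)]
    congr 1
    · refine Finset.sum_congr rfl fun G hG ↦ ?_
      rw [sup_edge_of_adj _ (by simpa using hG), smul_smul]
    · refine Finset.sum_congr rfl fun G hG ↦ ?_
      rw [smul_smul, mul_binomialRandom_real_singleton hij (by simpa using hG)]
  rw [h1, sum_filter_not_adj_eq hij
    (fun G ↦ ((1 - (p : ℝ)) * (binomialRandom V p).real {G}) • F G), ← Finset.sum_add_distrib]
  simp only [gnpExp, smul_ite, smul_zero, Finset.sum_filter]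
  refine Finset.sum_congr rfl fun G _ ↦ ?_
  split_ifs
  · rw [← add_smul]
    ring_nf
  · rfl

open scoped Classical in
lemma smul_gnpExp_sdiff_edge (hij : i ≠ j) (F : SimpleGraph V → E) :
    (1 - (p : ℝ)) • gnpExp p (fun G ↦ F (G \ edge i j)) =
      gnpExp p (fun G ↦ if G.Adj i j then 0 else F G) := by
  have h1 : (1 - (p : ℝ)) • gnpExp p (fun G ↦ F (G \ edge i j)) =
      ∑ G with G.Adj i j, ((1 - (p : ℝ)) * (binomialRandom V p).real {G}) • F (G \ edge i j) +
      ∑ G with ¬ G.Adj i j, ((1 - (p : ℝ)) * (binomialRandom V p).real {G}) • F G := by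
    rw [gnpExp, Finset.smul_sum, ← Finset.sum_filter_add_sum_filter_not _ (fun G ↦ G.Adj i j)]
    congr 1
    · exact Finset.sum_congr rfl fun G hG ↦ smul_smul _ _ _
    · refine Finset.sum_congr rfl fun G hG ↦ ?_
      rw [smul_smul, sdiff_edge _ (by simpa using hG)]
  rw [h1, ← sum_filter_not_adj_eq hij, ← Finset.sum_add_distrib]
  simp only [gnpExp, smul_ite, smul_zero, Finset.sum_filter]
  refine Finset.sum_congr rfl fun G _ ↦ ?_
  by_cases h : G.Adj i j
  · simp [h]
  · simp only [h, not_false_eq_true, if_true, if_false]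
    rw [← mul_binomialRandom_real_singleton hij h, sup_edge_sdiff_edge h, ← add_smul]
    ring_nf

lemma gnpExp_add (F F' : SimpleGraph V → E) :
    gnpExp p (fun G ↦ F G + F' G) = gnpExp p F + gnpExp p F' := by
  simp [gnpExp, Finset.sum_add_distrib]

lemma gnpExp_sub (F F' : SimpleGraph V → E) :
    gnpExp p (fun G ↦ F G - F' G) = gnpExp p F - gnpExp p F' := by
  simp [gnpExp, smul_sub, Finset.sum_sub_distrib]

lemma gnpExp_smul (c : ℝ) (F : SimpleGraph V → E) :
    gnpExp p (fun G ↦ c • F G) = c • gnpExp p F := by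
  simp only [gnpExp, Finset.smul_sum]
  exact Finset.sum_congr rfl fun G _ ↦ smul_comm _ _ _

lemma gnpExp_mul_left (c : ℂ) (F : SimpleGraph V → ℂ) :
    gnpExp p (fun G ↦ c * F G) = c * gnpExp p F := by
  simp only [gnpExp, Finset.mul_sum]
  exact Finset.sum_congr rfl fun G _ ↦ (mul_smul_comm _ _ _).symm

lemma gnpExp_sum {ι : Type*} (s : Finset ι) (F : ι → SimpleGraph V → E) :
    gnpExp p (fun G ↦ ∑ k ∈ s, F k G) = ∑ k ∈ s, gnpExp p (F k) := by
  simp only [gnpExp, Finset.smul_sum]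
  exact Finset.sum_comm

lemma norm_gnpExp_le {F : SimpleGraph V → ℂ} {f : SimpleGraph V → ℝ} (h : ∀ G, ‖F G‖ ≤ f G) :
    ‖gnpExp p F‖ ≤ gnpExp p f := by
  refine (norm_sum_le _ _).trans (Finset.sum_le_sum fun G _ ↦ ?_)
  rw [norm_smul, smul_eq_mul, Real.norm_of_nonneg measureReal_nonneg]
  exact mul_le_mul_of_nonneg_left (h G) measureReal_nonneg

lemma gnpExp_mono {f f' : SimpleGraph V → ℝ} (h : ∀ G, f G ≤ f' G) :
    gnpExp p f ≤ gnpExp p f' :=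
  Finset.sum_le_sum fun G _ ↦ mul_le_mul_of_nonneg_left (h G) measureReal_nonneg

lemma gnpExp_const (c : ℝ) : gnpExp p (fun _ : SimpleGraph V ↦ c) = c := by
  simp only [gnpExp, smul_eq_mul, ← Finset.sum_mul]
  rw [sum_binomialRandom_real_singleton, one_mul]

lemma gnpExp_nonneg {f : SimpleGraph V → ℝ} (h : ∀ G, 0 ≤ f G) : 0 ≤ gnpExp p f :=
  Finset.sum_nonneg fun G _ ↦ mul_nonneg measureReal_nonneg (h G)

lemma norm_gnpExp_le_const {F : SimpleGraph V → ℂ} {c : ℝ} (h : ∀ G, ‖F G‖ ≤ c) :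
    ‖gnpExp p F‖ ≤ c :=
  (norm_gnpExp_le h).trans (gnpExp_const c).le

open scoped Classical in
/-- Integration by parts for the indicator of an edge of the binomial random graph. -/
lemma gnpExp_ite_adj (hij : i ≠ j) (F : SimpleGraph V → E) :
    gnpExp p (fun G ↦ if G.Adj i j then F G else 0) =
      (p : ℝ) • gnpExp p F + ((p : ℝ) * (1 - (p : ℝ))) •
        gnpExp p (fun G ↦ F (G ⊔ edge i j) - F (G \ edge i j)) := by
  have h : gnpExp p F = (p : ℝ) • gnpExp p (fun G ↦ F (G ⊔ edge i j)) +
      (1 - (p : ℝ)) • gnpExp p (fun G ↦ F (G \ edge i j)) := by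
    rw [smul_gnpExp_sup_edge hij, smul_gnpExp_sdiff_edge hij, ← gnpExp_add]
    congr 1
    ext G
    split_ifs <;> simp
  rw [← smul_gnpExp_sup_edge hij, h, gnpExp_sub]
  module

/-- Jensen's inequality for the square. -/
lemma sq_gnpExp_le (f : SimpleGraph V → ℝ) :
    gnpExp p f ^ 2 ≤ gnpExp p (fun G ↦ f G ^ 2) := by
  have h : 0 ≤ gnpExp p (fun G ↦ (f G - gnpExp p f) ^ 2) := gnpExp_nonneg fun G ↦ sq_nonneg _
  have h2 : gnpExp p (fun G ↦ (f G - gnpExp p f) ^ 2) =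
      gnpExp p (fun G ↦ f G ^ 2) - gnpExp p f ^ 2 := by
    have : (fun G ↦ (f G - gnpExp p f) ^ 2) = fun G ↦
        (f G ^ 2 - (2 * gnpExp p f) • f G) + gnpExp p f ^ 2 := by
      ext G
      simp only [smul_eq_mul]
      ring
    rw [this, gnpExp_add, gnpExp_sub, gnpExp_smul, gnpExp_const, smul_eq_mul]
    ring
  linarith

open scoped Classical in
lemma binomialRandom_real_eq_gnpExp (S : Set (SimpleGraph V)) :
    (binomialRandom V p).real S = gnpExp p (fun G ↦ if G ∈ S then (1 : ℝ) else 0) := by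
  have : S = ((Finset.univ.filter (· ∈ S) : Finset (SimpleGraph V)) : Set (SimpleGraph V)) := by
    ext G
    simp
  conv_lhs => rw [this]
  have : MeasurableSingletonClass (SimpleGraph V) := measurableSingletonClass_simpleGraph
  rw [← sum_measureReal_singleton]
  simp [gnpExp, Finset.sum_filter]

/-- Markov's inequality. -/
lemma mul_binomialRandom_real_le {f : SimpleGraph V → ℝ} (hf : ∀ G, 0 ≤ f G) (c : ℝ) :
    c * (binomialRandom V p).real {G | c ≤ f G} ≤ gnpExp p f := by
  classical
  rw [binomialRandom_real_eq_gnpExp, ← smul_eq_mul, ← gnpExp_smul]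
  refine gnpExp_mono fun G ↦ ?_
  simp only [Set.mem_ofPred_eq, smul_eq_mul]
  split_ifs with h
  · simpa using h
  · simpa using hf G

end Expectation

end SimpleGraph

/-! ### The self-consistent equation and its variation when an edge is switched. -/

namespace SimpleGraph

open MeasureTheory Matrix

open scoped Matrix.Norms.L2Operator ComplexConjugate

section RealAdj

variable {V : Type*}

open scoped Classical in
/-- The real adjacency matrix of a graph, with classical decidability. -/
noncomputable def realAdj (G : SimpleGraph V) : Matrix V V ℝ := G.adjMatrix ℝ

open scoped Classical in
lemma realAdj_apply (G : SimpleGraph V) (i j : V) :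
    G.realAdj i j = if G.Adj i j then 1 else 0 :=
  adjMatrix_apply ..

lemma isHermitian_smul_realAdj (a : ℝ) (G : SimpleGraph V) : (a • G.realAdj).IsHermitian := by
  classical
  have h : G.realAdj.IsHermitian := G.isHermitian_adjMatrix (R := ℝ)
  rw [IsHermitian, conjTranspose_smul, h.eq, star_trivial]

lemma realAdj_sdiff_sub_sup [DecidableEq V] {i j : V} (hij : i ≠ j) (a : ℝ) (G : SimpleGraph V) :
    ((a • (G \ edge i j).realAdj).map (↑) - (a • (G ⊔ edge i j).realAdj).map (↑) :
      Matrix V V ℂ) = (-a : ℂ) • symmSingle i j := by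
  ext k l
  simp only [realAdj_apply, Matrix.sub_apply, map_apply, Matrix.smul_apply, symmSingle,
    Matrix.add_apply, single_apply, smul_eq_mul]
  by_cases h1 : i = k ∧ j = l
  · obtain ⟨rfl, rfl⟩ := h1
    rw [if_neg (not_adj_sdiff_edge G), if_pos (adj_sup_edge G hij)]
    simp [hij, hij.symm]
  · by_cases h2 : j = k ∧ i = l
    · obtain ⟨rfl, rfl⟩ := h2
      rw [if_neg (mt Adj.symm (not_adj_sdiff_edge G)), if_pos (adj_sup_edge G hij).symm]
      simp [hij, hij.symm]
    · have h3 : ¬ (k = i ∧ l = j) := fun h ↦ h1 ⟨h.1.symm, h.2.symm⟩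
      have h4 : ¬ (k = j ∧ l = i) := fun h ↦ h2 ⟨h.1.symm, h.2.symm⟩
      have h5 : (G \ edge i j).Adj k l ↔ G.Adj k l := by simp [edge_adj, h3, h4]
      have h6 : (G ⊔ edge i j).Adj k l ↔ G.Adj k l := by simp [edge_adj, h3, h4]
      by_cases h : G.Adj k l
      · rw [if_pos (h5.2 h), if_pos (h6.2 h)]
        simp [h1, h2]
      · rw [if_neg (mt h5.1 h), if_neg (mt h6.1 h)]
        simp [h1, h2]

end RealAdj

section SelfConsistent

variable {V : Type*} [Fintype V] [DecidableEq V]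

/-- The resolvent at `t * I` of the adjacency matrix scaled by `a`. -/
noncomputable def graphResolvent (a t : ℝ) (G : SimpleGraph V) : Matrix V V ℂ :=
  imResolvent (a • G.realAdj) t

/-- The Stieltjes transform at `t * I` of the spectral measure of the scaled adjacency matrix. -/
noncomputable def graphStieltjes (a t : ℝ) (G : SimpleGraph V) : ℂ :=
  (Fintype.card V : ℂ)⁻¹ * (graphResolvent a t G).trace

/-- The defect in the quadratic equation satisfied by the Stieltjes transform of a semicircle law
of variance `v`. -/
noncomputable def quadDefect (v a t : ℝ) (G : SimpleGraph V) : ℂ :=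
  v * graphStieltjes a t G ^ 2 + t * Complex.I * graphStieltjes a t G + 1

variable {a t v : ℝ} {i j : V}

lemma norm_graphResolvent_le (ht : 0 < t) (G : SimpleGraph V) : ‖graphResolvent a t G‖ ≤ t⁻¹ :=
  (isHermitian_smul_realAdj a G).norm_imResolvent_le ht

lemma norm_graphResolvent_apply_le (ht : 0 < t) (G : SimpleGraph V) (i j : V) :
    ‖graphResolvent a t G i j‖ ≤ t⁻¹ :=
  (norm_apply_le_l2_opNorm _ i j).trans (norm_graphResolvent_le ht G)

lemma norm_graphStieltjes_le [Nonempty V] (ht : 0 < t) (G : SimpleGraph V) :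
    ‖graphStieltjes a t G‖ ≤ t⁻¹ := by
  have hn : (0 : ℝ) < Fintype.card V := by exact_mod_cast Fintype.card_pos
  rw [graphStieltjes, norm_mul, norm_inv, Complex.norm_natCast]
  calc _ ≤ (Fintype.card V : ℝ)⁻¹ * (Fintype.card V * t⁻¹) := by
        gcongr
        exact (norm_trace_le _).trans (by gcongr; exact norm_graphResolvent_le ht G)
    _ = t⁻¹ := by field_simp

lemma norm_quadDefect_le [Nonempty V] (ht : 0 < t) (hv0 : 0 ≤ v) (hv1 : v ≤ 1)
    (G : SimpleGraph V) : ‖quadDefect v a t G‖ ≤ t⁻¹ ^ 2 + 2 := by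
  have h := norm_graphStieltjes_le (a := a) ht G
  have h1 : ‖(v : ℂ) * graphStieltjes a t G ^ 2‖ ≤ 1 * t⁻¹ ^ 2 := by
    rw [norm_mul, norm_pow, Complex.norm_real, Real.norm_of_nonneg hv0]
    gcongr
  have h2 : ‖t * Complex.I * graphStieltjes a t G‖ ≤ t * t⁻¹ := by
    rw [norm_mul, norm_mul, Complex.norm_real, Complex.norm_I, Real.norm_of_nonneg ht.le, mul_one]
    gcongr
  rw [mul_inv_cancel₀ ht.ne'] at h2
  calc _ ≤ ‖(v : ℂ) * graphStieltjes a t G ^ 2‖ + ‖t * Complex.I * graphStieltjes a t G‖ +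
        ‖(1 : ℂ)‖ := norm_add₃_le
    _ ≤ _ := by
      rw [norm_one]
      linarith

open scoped Classical in
-- The trace of `IsHermitian.map_mul_imResolvent` turns 1 + i t s into a sum over edges, ready for
-- integration by parts.
lemma quadDefect_eq [Nonempty V] (ht : 0 < t) (G : SimpleGraph V) :
    quadDefect v a t G = v * graphStieltjes a t G ^ 2 + a * (Fintype.card V : ℂ)⁻¹ *
      ∑ i, ∑ j, if G.Adj i j then graphResolvent a t G j i else 0 := by
  have hn : (Fintype.card V : ℂ) ≠ 0 := by exact_mod_cast Fintype.card_ne_zero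
  have h := congrArg trace ((isHermitian_smul_realAdj a G).map_mul_imResolvent ht.ne')
  rw [trace_add, trace_smul, trace_one] at h
  have h2 : (((a • G.realAdj).map (↑) : Matrix V V ℂ) * imResolvent (a • G.realAdj) t).trace =
      a * ∑ i, ∑ j, if G.Adj i j then graphResolvent a t G j i else 0 := by
    simp only [trace, diag_apply, mul_apply, Finset.mul_sum]
    refine Finset.sum_congr rfl fun i _ ↦ Finset.sum_congr rfl fun j _ ↦ ?_
    rw [map_apply, Matrix.smul_apply, realAdj_apply, graphResolvent]
    split_ifs <;> simp
  rw [h2, smul_eq_mul] at h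
  rw [quadDefect, mul_right_comm (a : ℂ), h, graphStieltjes, graphResolvent]
  field_simp
  ring

lemma graphResolvent_sup_sub_sdiff (hij : i ≠ j) (ht : 0 < t) (G : SimpleGraph V) :
    graphResolvent a t (G ⊔ edge i j) - graphResolvent a t (G \ edge i j) =
      (-a : ℂ) • (graphResolvent a t (G ⊔ edge i j) * symmSingle i j *
        graphResolvent a t (G \ edge i j)) := by
  rw [graphResolvent, graphResolvent, (isHermitian_smul_realAdj a _).imResolvent_sub
    (isHermitian_smul_realAdj a _) ht.ne', realAdj_sdiff_sub_sup hij, mul_smul_comm,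
    smul_mul_assoc]

lemma norm_mul_symmSingle_mul_le {B C : Matrix V V ℂ} {b c : ℝ} (hB : ‖B‖ ≤ b) (hC : ‖C‖ ≤ c) :
    ‖B * symmSingle i j * C‖ ≤ 2 * (b * c) := by
  have hb := (norm_nonneg B).trans hB
  calc _ ≤ ‖B‖ * ‖symmSingle i j‖ * ‖C‖ :=
        (norm_mul_le _ _).trans (by gcongr; exact norm_mul_le _ _)
    _ ≤ b * 2 * c := by
        gcongr
        exact norm_symmSingle_le i j
    _ = _ := by ring

lemma norm_graphResolvent_sup_sub_sdiff_le (hij : i ≠ j) (ha : 0 ≤ a) (ht : 0 < t)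
    (G : SimpleGraph V) :
    ‖graphResolvent a t (G ⊔ edge i j) - graphResolvent a t (G \ edge i j)‖ ≤
      2 * a * t⁻¹ ^ 2 := by
  rw [graphResolvent_sup_sub_sdiff hij ht, norm_smul, norm_neg, Complex.norm_real,
    Real.norm_of_nonneg ha]
  calc _ ≤ a * (2 * (t⁻¹ * t⁻¹)) := by
        gcongr
        exact norm_mul_symmSingle_mul_le (norm_graphResolvent_le ht _)
          (norm_graphResolvent_le ht _)
    _ = _ := by ring

/-- Second-order expansion of the resolvent when an edge is switched. -/
lemma norm_graphResolvent_sup_sub_sdiff_add_le (hij : i ≠ j) (ha : 0 ≤ a) (ht : 0 < t)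
    (G : SimpleGraph V) :
    ‖graphResolvent a t (G ⊔ edge i j) - graphResolvent a t (G \ edge i j) +
      (a : ℂ) • (graphResolvent a t G * symmSingle i j * graphResolvent a t G)‖ ≤
      4 * a ^ 2 * t⁻¹ ^ 3 := by
  set Rp := graphResolvent a t (G ⊔ edge i j) with hRp
  set Rm := graphResolvent a t (G \ edge i j) with hRm
  have hp : ‖Rp‖ ≤ t⁻¹ := norm_graphResolvent_le ht _
  have hm : ‖Rm‖ ≤ t⁻¹ := norm_graphResolvent_le ht _
  have hd : ‖Rp - Rm‖ ≤ 2 * a * t⁻¹ ^ 2 := norm_graphResolvent_sup_sub_sdiff_le hij ha ht G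
  have he : Rp - Rm = (-a : ℂ) • (Rp * symmSingle i j * Rm) :=
    graphResolvent_sup_sub_sdiff hij ht G
  -- G is itself one of the two switched graphs, so the exact resolvent identity differs from the
  -- claim in a single factor, replaced at cost ‖Rp - Rm‖ = O(a).
  by_cases h : G.Adj i j
  · have hG : graphResolvent a t G = Rp := by rw [hRp, sup_edge_of_adj _ h]
    have : Rp - Rm + (a : ℂ) • (Rp * symmSingle i j * Rp) =
        (a : ℂ) • (Rp * symmSingle i j * (Rp - Rm)) := by
      rw [mul_sub, smul_sub]
      nth_rewrite 1 [he]
      module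
    rw [hG, this, norm_smul, Complex.norm_real, Real.norm_of_nonneg ha]
    calc _ ≤ a * (2 * (t⁻¹ * (2 * a * t⁻¹ ^ 2))) := by
          gcongr
          exact norm_mul_symmSingle_mul_le hp hd
      _ = _ := by ring
  · have hG : graphResolvent a t G = Rm := by rw [hRm, sdiff_edge _ h]
    have : Rp - Rm + (a : ℂ) • (Rm * symmSingle i j * Rm) =
        (-a : ℂ) • ((Rp - Rm) * symmSingle i j * Rm) := by
      rw [sub_mul, sub_mul, smul_sub]
      nth_rewrite 1 [he]
      module
    rw [hG, this, norm_smul, norm_neg, Complex.norm_real, Real.norm_of_nonneg ha]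
    calc _ ≤ a * (2 * ((2 * a * t⁻¹ ^ 2) * t⁻¹)) := by
          gcongr
          exact norm_mul_symmSingle_mul_le hd hm
      _ = _ := by ring

lemma norm_graphStieltjes_sup_sub_sdiff_le [Nonempty V] (hij : i ≠ j) (ha : 0 ≤ a) (ht : 0 < t)
    (G : SimpleGraph V) :
    ‖graphStieltjes a t (G ⊔ edge i j) - graphStieltjes a t (G \ edge i j)‖ ≤
      2 * t⁻¹ ^ 2 * (a * (Fintype.card V : ℝ)⁻¹) := by
  rw [graphStieltjes, graphStieltjes, ← mul_sub, ← trace_sub, graphResolvent_sup_sub_sdiff hij ht,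
    trace_smul, norm_mul, norm_smul, norm_neg, norm_inv, Complex.norm_natCast, Complex.norm_real,
    Real.norm_of_nonneg ha]
  calc _ ≤ (Fintype.card V : ℝ)⁻¹ * (a * (2 * (t⁻¹ * t⁻¹))) := by
        gcongr
        refine (norm_trace_mul_symmSingle_mul_le _ _ i j).trans ?_
        gcongr <;> exact norm_graphResolvent_le ht _
    _ = _ := by ring

lemma norm_quadDefect_sup_sub_sdiff_le [Nonempty V] (hij : i ≠ j) (ha : 0 ≤ a) (ht : 0 < t)
    (hv0 : 0 ≤ v) (hv1 : v ≤ 1) (G : SimpleGraph V) :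
    ‖quadDefect v a t (G ⊔ edge i j) - quadDefect v a t (G \ edge i j)‖ ≤
      (2 * t⁻¹ + t) * (2 * t⁻¹ ^ 2) * (a * (Fintype.card V : ℝ)⁻¹) := by
  have h := norm_graphStieltjes_sup_sub_sdiff_le hij ha ht G
  have hp := norm_graphStieltjes_le (a := a) ht (G ⊔ edge i j)
  have hm := norm_graphStieltjes_le (a := a) ht (G \ edge i j)
  have he : quadDefect v a t (G ⊔ edge i j) - quadDefect v a t (G \ edge i j) =
      (v * (graphStieltjes a t (G ⊔ edge i j) + graphStieltjes a t (G \ edge i j)) +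
        t * Complex.I) *
      (graphStieltjes a t (G ⊔ edge i j) - graphStieltjes a t (G \ edge i j)) := by
    simp only [quadDefect]
    ring
  rw [he, norm_mul, mul_assoc]
  gcongr
  refine norm_add_le_of_le ?_ ?_
  · rw [norm_mul, Complex.norm_real, Real.norm_of_nonneg hv0]
    calc _ ≤ 1 * (t⁻¹ + t⁻¹) := by
          gcongr
          exact norm_add_le_of_le hp hm
      _ = _ := by ring
  · rw [norm_mul, Complex.norm_real, Complex.norm_I, Real.norm_of_nonneg ht.le, mul_one]

lemma norm_quadDefect_sup_sub_le [Nonempty V] (hij : i ≠ j) (ha : 0 ≤ a) (ht : 0 < t)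
    (hv0 : 0 ≤ v) (hv1 : v ≤ 1) (G : SimpleGraph V) :
    ‖quadDefect v a t (G ⊔ edge i j) - quadDefect v a t G‖ ≤
      (2 * t⁻¹ + t) * (2 * t⁻¹ ^ 2) * (a * (Fintype.card V : ℝ)⁻¹) := by
  by_cases h : G.Adj i j
  · rw [sup_edge_of_adj _ h, sub_self, norm_zero]
    positivity
  · simpa [sdiff_edge _ h] using norm_quadDefect_sup_sub_sdiff_le hij ha ht hv0 hv1 G

/-- The first-order expansion, when the edge `ij` is switched, of the product of a resolvent entry
and the conjugate of the defect. -/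
lemma norm_resolvent_mul_defect_sup_sub_sdiff_add_le [Nonempty V] (hij : i ≠ j) (ha : 0 ≤ a)
    (ha1 : a ≤ 1) (hn : a ^ 2 * Fintype.card V = 1) (ht : 0 < t) (hv0 : 0 ≤ v) (hv1 : v ≤ 1)
    (G : SimpleGraph V) :
    ‖graphResolvent a t (G ⊔ edge i j) j i * conj (quadDefect v a t (G ⊔ edge i j)) -
      graphResolvent a t (G \ edge i j) j i * conj (quadDefect v a t (G \ edge i j)) +
      a * ((graphResolvent a t G j i * graphResolvent a t G j i +
        graphResolvent a t G j j * graphResolvent a t G i i) * conj (quadDefect v a t G))‖ ≤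
      (4 * t⁻¹ ^ 3 * (t⁻¹ ^ 2 + 2) + 6 * t⁻¹ ^ 3 * (2 * t⁻¹ + t)) * a ^ 2 := by
  have hcard : (Fintype.card V : ℝ)⁻¹ = a ^ 2 := inv_eq_of_mul_eq_one_left hn
  -- The defect varies by only O(a³); O(a²) suffices, since there are n² = a⁻⁴ ordered pairs and a
  -- total error O(n) is affordable.
  have han : a * (Fintype.card V : ℝ)⁻¹ ≤ a ^ 2 := by
    rw [hcard]
    exact mul_le_of_le_one_left (sq_nonneg a) ha1
  have h1 := norm_graphResolvent_sup_sub_sdiff_add_le hij ha ht G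
  have h1' := (norm_apply_le_l2_opNorm _ j i).trans h1
  rw [Matrix.add_apply, Matrix.smul_apply, mul_symmSingle_mul_apply, Matrix.sub_apply,
    smul_eq_mul] at h1'
  have hK := norm_quadDefect_le (a := a) ht hv0 hv1 G
  have hD := norm_quadDefect_sup_sub_sdiff_le hij ha ht hv0 hv1 G
  have hD' := norm_quadDefect_sup_sub_le hij ha ht hv0 hv1 G
  have hRp := norm_graphResolvent_apply_le (a := a) ht (G ⊔ edge i j) j i
  have hRm := norm_graphResolvent_apply_le (a := a) ht (G \ edge i j) j i
  have hD1 : (2 * t⁻¹ + t) * (2 * t⁻¹ ^ 2) * (a * (Fintype.card V : ℝ)⁻¹) ≤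
      (2 * t⁻¹ + t) * (2 * t⁻¹ ^ 2) * a ^ 2 := by gcongr
  replace hD := hD.trans hD1
  replace hD' := hD'.trans hD1
  rw [← Complex.norm_conj, map_sub] at hD hD'
  rw [← Complex.norm_conj] at hK
  set Qp := conj (quadDefect v a t (G ⊔ edge i j))
  set Qm := conj (quadDefect v a t (G \ edge i j))
  set Q := conj (quadDefect v a t G)
  set rp := graphResolvent a t (G ⊔ edge i j) j i
  set rm := graphResolvent a t (G \ edge i j) j i
  set W := graphResolvent a t G j i * graphResolvent a t G j i +
        graphResolvent a t G j j * graphResolvent a t G i i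
  -- Discrete product rule: only the first term needs the second-order expansion, since the
  -- variation of the defect is already negligible.
  have he : rp * Qp - rm * Qm + a * (W * Q) =
      (rp - rm + a * W) * Q + (rp - rm) * (Qp - Q) + rm * (Qp - Qm) := by ring
  rw [he]
  calc _ ≤ ‖rp - rm + a * W‖ * ‖Q‖ + ‖rp - rm‖ * ‖Qp - Q‖ + ‖rm‖ * ‖Qp - Qm‖ := by
        simpa only [norm_mul] using norm_add₃_le (a := (rp - rm + a * W) * Q)
          (b := (rp - rm) * (Qp - Q)) (c := rm * (Qp - Qm))
    _ ≤ (4 * a ^ 2 * t⁻¹ ^ 3) * (t⁻¹ ^ 2 + 2) +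
        (t⁻¹ + t⁻¹) * ((2 * t⁻¹ + t) * (2 * t⁻¹ ^ 2) * a ^ 2) +
        t⁻¹ * ((2 * t⁻¹ + t) * (2 * t⁻¹ ^ 2) * a ^ 2) := by
        gcongr
        exact norm_sub_le_of_le hRp hRm
    _ = _ := by ring

end SelfConsistent

end SimpleGraph

/-! ### Second moment of the defect. -/

namespace SimpleGraph

open MeasureTheory Matrix

open scoped Matrix.Norms.L2Operator ComplexConjugate

section SecondMoment

variable {V : Type*} [Fintype V] [DecidableEq V] {p : unitInterval} {a t : ℝ}

open scoped Classical in
-- Integration by parts fails on the diagonal, where a crude O(1) bound is enough: n diagonal pairs,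
-- and n² pairs with error a² = 1/n, both total O(n).
lemma norm_gnpExp_resolvent_mul_defect_le [Nonempty V] (ha : 0 ≤ a)
    (ha1 : a ≤ 1) (hn : a ^ 2 * Fintype.card V = 1) (ht : 0 < t) (i j : V) {v : ℝ}
    (hv : v = (p : ℝ) * (1 - p)) :
    ‖gnpExp p (fun G ↦ if G.Adj i j then
          graphResolvent a t G j i * conj (quadDefect v a t G) else 0) -
        p * gnpExp p (fun G ↦ graphResolvent a t G j i * conj (quadDefect v a t G)) +
        v * (a * gnpExp p (fun G ↦
          (graphResolvent a t G j i * graphResolvent a t G j i +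
            graphResolvent a t G j j * graphResolvent a t G i i) * conj (quadDefect v a t G)))‖ ≤
      (if i = j then (t⁻¹ + 2 * t⁻¹ ^ 2) * (t⁻¹ ^ 2 + 2) else 0) +
      (4 * t⁻¹ ^ 3 * (t⁻¹ ^ 2 + 2) + 6 * t⁻¹ ^ 3 * (2 * t⁻¹ + t)) * a ^ 2 := by
  have hp0 : (0 : ℝ) ≤ p := p.2.1
  have hp1 : (p : ℝ) ≤ 1 := p.2.2
  have hv0 : 0 ≤ v := by rw [hv]; exact mul_nonneg hp0 (by linarith)
  have hv1 : v ≤ 1 := by rw [hv]; nlinarith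
  have hK (G : SimpleGraph V) : ‖conj (quadDefect v a t G)‖ ≤ t⁻¹ ^ 2 + 2 := by
    rw [Complex.norm_conj]
    exact norm_quadDefect_le ht hv0 hv1 G
  have hR (G : SimpleGraph V) (i j : V) : ‖graphResolvent a t G i j‖ ≤ t⁻¹ :=
    norm_graphResolvent_apply_le ht G i j
  by_cases hij : i = j
  · subst hij
    have h1 : ‖gnpExp p (fun G ↦ graphResolvent a t G i i * conj (quadDefect v a t G))‖ ≤
        t⁻¹ * (t⁻¹ ^ 2 + 2) := norm_gnpExp_le_const fun G ↦ by
      rw [norm_mul]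
      gcongr
      exacts [hR G i i, hK G]
    have h2 : ‖gnpExp p (fun G ↦
          (graphResolvent a t G i i * graphResolvent a t G i i +
            graphResolvent a t G i i * graphResolvent a t G i i) *
            conj (quadDefect v a t G))‖ ≤ (t⁻¹ * t⁻¹ + t⁻¹ * t⁻¹) * (t⁻¹ ^ 2 + 2) :=
      norm_gnpExp_le_const fun G ↦ by
        rw [norm_mul]
        gcongr
        · refine norm_add_le_of_le ?_ ?_ <;>
          · rw [norm_mul]
            gcongr <;> exact hR G i i
        · exact hK G
    have h0 : gnpExp p (fun G : SimpleGraph V ↦ if G.Adj i i then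
          graphResolvent a t G i i * conj (quadDefect v a t G) else 0) = 0 := by
      simp [gnpExp]
    rw [h0, zero_sub, if_pos rfl]
    refine (norm_add_le _ _).trans ?_
    rw [norm_neg, norm_mul, norm_mul, norm_mul, Complex.norm_real, Complex.norm_real,
      Complex.norm_real, Real.norm_of_nonneg hv0, Real.norm_of_nonneg ha,
      Real.norm_of_nonneg hp0]
    calc _ ≤ 1 * (t⁻¹ * (t⁻¹ ^ 2 + 2)) +
          1 * (1 * ((t⁻¹ * t⁻¹ + t⁻¹ * t⁻¹) * (t⁻¹ ^ 2 + 2))) := by gcongr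
      _ = (t⁻¹ + 2 * t⁻¹ ^ 2) * (t⁻¹ ^ 2 + 2) + 0 := by ring
      _ ≤ _ := by
        gcongr
        positivity
  · rw [if_neg hij, zero_add, gnpExp_ite_adj hij, ← hv, Complex.real_smul, Complex.real_smul,
      add_sub_cancel_left, ← mul_add, ← gnpExp_mul_left, ← gnpExp_add, norm_mul,
      Complex.norm_real, Real.norm_of_nonneg hv0]
    refine (mul_le_of_le_one_left (norm_nonneg _) hv1).trans ?_
    exact norm_gnpExp_le_const fun G ↦
      norm_resolvent_mul_defect_sup_sub_sdiff_add_le hij ha ha1 hn ht hv0 hv1 G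

/-- The constant in the second moment bound for the defect. -/
noncomputable def defectConst (t : ℝ) : ℝ :=
  (t⁻¹ + 2 * t⁻¹ ^ 2) * (t⁻¹ ^ 2 + 2) +
    (4 * t⁻¹ ^ 3 * (t⁻¹ ^ 2 + 2) + 6 * t⁻¹ ^ 3 * (2 * t⁻¹ + t)) +
    t⁻¹ * (t⁻¹ ^ 2 + 2) + t⁻¹ ^ 2 * (t⁻¹ ^ 2 + 2)

/-- The self-consistent equation holds in mean square. -/
theorem gnpExp_sq_norm_quadDefect_le [Nonempty V] (ha : 0 ≤ a)
    (ha1 : a ≤ 1) (hn : a ^ 2 * Fintype.card V = 1) (ht : 0 < t) {v : ℝ}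
    (hv : v = (p : ℝ) * (1 - p)) :
    gnpExp p (fun G : SimpleGraph V ↦ ‖quadDefect v a t G‖ ^ 2) ≤ defectConst t * a := by
  classical
  have hp0 : (0 : ℝ) ≤ p := p.2.1
  have hp1 : (p : ℝ) ≤ 1 := p.2.2
  have hv0 : 0 ≤ v := by rw [hv]; exact mul_nonneg hp0 (by linarith)
  have hv1 : v ≤ 1 := by rw [hv]; nlinarith
  have hK (G : SimpleGraph V) : ‖conj (quadDefect v a t G)‖ ≤ t⁻¹ ^ 2 + 2 := by
    rw [Complex.norm_conj]
    exact norm_quadDefect_le ht hv0 hv1 G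
  set n : ℝ := (Fintype.card V : ℝ) with hndef
  have hn0 : 0 < n := by
    rw [hndef]
    exact_mod_cast Fintype.card_pos
  set Q : SimpleGraph V → ℂ := fun G ↦ quadDefect v a t G with hQ
  set R : SimpleGraph V → Matrix V V ℂ := fun G ↦ graphResolvent a t G with hR
  set X : V → V → ℂ := fun i j ↦ gnpExp p (fun G ↦ if G.Adj i j then R G j i * conj (Q G) else 0)
  set F : V → V → ℂ := fun i j ↦ gnpExp p (fun G ↦ R G j i * conj (Q G))
  set W : V → V → ℂ := fun i j ↦ gnpExp p (fun G ↦
    (R G j i * R G j i + R G j j * R G i i) * conj (Q G))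
  set S : ℂ := gnpExp p (fun G ↦ graphStieltjes a t G ^ 2 * conj (Q G)) with hS
  set Z : ℂ := gnpExp p (fun G ↦ (R G * R G).trace * conj (Q G)) with hZ
  have hY : ‖∑ i, ∑ j, (X i j - p * F i j + v * (a * W i j))‖ ≤
      n * ((t⁻¹ + 2 * t⁻¹ ^ 2) * (t⁻¹ ^ 2 + 2) +
        (4 * t⁻¹ ^ 3 * (t⁻¹ ^ 2 + 2) + 6 * t⁻¹ ^ 3 * (2 * t⁻¹ + t))) := by
    calc _ ≤ ∑ i : V, ∑ j : V, ((if i = j then (t⁻¹ + 2 * t⁻¹ ^ 2) * (t⁻¹ ^ 2 + 2) else 0) +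
          (4 * t⁻¹ ^ 3 * (t⁻¹ ^ 2 + 2) + 6 * t⁻¹ ^ 3 * (2 * t⁻¹ + t)) * a ^ 2) :=
          norm_sum_le_of_le _ fun i _ ↦ norm_sum_le_of_le _ fun j _ ↦
            norm_gnpExp_resolvent_mul_defect_le ha ha1 hn ht i j hv
      _ = n * ((t⁻¹ + 2 * t⁻¹ ^ 2) * (t⁻¹ ^ 2 + 2) +
          (4 * t⁻¹ ^ 3 * (t⁻¹ ^ 2 + 2) + 6 * t⁻¹ ^ 3 * (2 * t⁻¹ + t)) * (a ^ 2 * n)) := by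
          simp only [Finset.sum_add_distrib, Finset.sum_ite_eq, Finset.mem_univ, if_true,
            Finset.sum_const, Finset.card_univ, nsmul_eq_mul, ← hndef]
          ring
      _ = _ := by rw [hn, mul_one]
  -- Contribution of the mean of the adjacency matrix, through the all-ones quadratic form of R.
  have hF : ‖∑ i, ∑ j, F i j‖ ≤ n * (t⁻¹ * (t⁻¹ ^ 2 + 2)) := by
    have : ∑ i, ∑ j, F i j = gnpExp p (fun G ↦ (∑ i, ∑ j, R G i j) * conj (Q G)) := by
      rw [Finset.sum_comm]
      simp only [F, ← gnpExp_sum, Finset.sum_mul]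
    rw [this]
    refine norm_gnpExp_le_const fun G ↦ ?_
    rw [norm_mul, ← mul_assoc]
    gcongr
    · exact (norm_sum_sum_apply_le _).trans (by gcongr; exact norm_graphResolvent_le ht G)
    · exact hK G
  have hZn : ‖Z‖ ≤ n * (t⁻¹ ^ 2 * (t⁻¹ ^ 2 + 2)) := by
    refine norm_gnpExp_le_const fun G ↦ ?_
    rw [norm_mul, ← mul_assoc]
    gcongr
    · refine (norm_trace_le _).trans ?_
      rw [sq]
      gcongr
      refine (norm_mul_le _ _).trans ?_
      gcongr <;> exact norm_graphResolvent_le ht G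
    · exact hK G
  -- By symmetry of R the squares R_ji² sum to tr R², which is O(n); the products R_jj R_ii sum to
  -- (n s)², the leading term.
  have hW : ∑ i, ∑ j, W i j = Z + (n : ℂ) ^ 2 * S := by
    rw [hZ, hS, ← gnpExp_mul_left, ← gnpExp_add]
    simp only [W, ← gnpExp_sum]
    congr 1
    ext G
    have hsymm (i j : V) : R G j i = R G i j := by
      have h : (R G)ᵀ = R G := (isHermitian_smul_realAdj a G).imResolvent_transpose
      exact congrFun (congrFun h i) j
    have h1 : (R G * R G).trace = ∑ i, ∑ j, R G j i * R G j i := by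
      simp only [trace, diag_apply, mul_apply]
      refine Finset.sum_congr rfl fun i _ ↦ Finset.sum_congr rfl fun j _ ↦ ?_
      rw [hsymm i j]
    have h2 : (n : ℂ) ^ 2 * graphStieltjes a t G ^ 2 = ∑ i, ∑ j, R G j j * R G i i := by
      have : (n : ℂ) * graphStieltjes a t G = ∑ i, R G i i := by
        rw [graphStieltjes, hndef, Complex.ofReal_natCast, mul_inv_cancel_left₀]
        · rfl
        · exact_mod_cast Fintype.card_ne_zero
      rw [← mul_pow, this, sq, Finset.sum_mul_sum, Finset.sum_comm]
    rw [h1, ← mul_assoc, h2, ← add_mul, ← Finset.sum_add_distrib, Finset.sum_mul]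
    refine Finset.sum_congr rfl fun i _ ↦ ?_
    rw [← Finset.sum_add_distrib, Finset.sum_mul]
  have hQQ : ((gnpExp p (fun G ↦ ‖Q G‖ ^ 2) : ℝ) : ℂ) =
      v * S + a * (n : ℂ)⁻¹ * ∑ i, ∑ j, X i j := by
    have h1 : ((gnpExp p (fun G ↦ ‖Q G‖ ^ 2) : ℝ) : ℂ) = gnpExp p (fun G ↦ Q G * conj (Q G)) := by
      simp only [gnpExp, smul_eq_mul, Complex.ofReal_sum, Complex.ofReal_mul, Complex.real_smul,
        Complex.mul_conj, Complex.normSq_eq_norm_sq]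
    rw [h1, hS, ← gnpExp_mul_left]
    simp only [X, ← gnpExp_sum]
    rw [← gnpExp_mul_left, ← gnpExp_add]
    congr 1
    ext G
    have h2 := quadDefect_eq (v := v) (a := a) ht G
    nth_rewrite 1 [hQ]
    simp only []
    rw [h2, hndef, Complex.ofReal_natCast, add_mul, mul_assoc, mul_assoc _ _ (conj (Q G)),
      Finset.sum_mul]
    congr 2
    refine Finset.sum_congr rfl fun i _ ↦ ?_
    rw [Finset.sum_mul]
    refine Finset.sum_congr rfl fun j _ ↦ ?_
    rw [ite_mul, zero_mul]
  have hnC : (n : ℂ) ≠ 0 := by exact_mod_cast hn0.ne'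
  have hanC : (a : ℂ) ^ 2 * n = 1 := by exact_mod_cast hn
  -- The leading term a n⁻¹ · v a n² S equals v S because a² n = 1, and cancels the v S in `hQQ`;
  -- every remaining sum is O(n), with prefactor a/n.
  have hfinal : ((gnpExp p (fun G ↦ ‖Q G‖ ^ 2) : ℝ) : ℂ) =
      a * (n : ℂ)⁻¹ * (∑ i, ∑ j, (X i j - p * F i j + v * (a * W i j)) + p * ∑ i, ∑ j, F i j -
        v * (a * Z)) := by
    have hsum : ∑ i, ∑ j, (X i j - p * F i j + v * (a * W i j)) =
        ∑ i, ∑ j, X i j - p * ∑ i, ∑ j, F i j + v * (a * ∑ i, ∑ j, W i j) := by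
      simp only [Finset.sum_add_distrib, Finset.sum_sub_distrib, Finset.mul_sum]
    rw [hQQ, hsum, hW]
    field_simp
    linear_combination (-(v * S * n) : ℂ) * hanC
  have hnorm : gnpExp p (fun G ↦ ‖Q G‖ ^ 2) =
      ‖((gnpExp p (fun G ↦ ‖Q G‖ ^ 2) : ℝ) : ℂ)‖ := by
    rw [Complex.norm_real, Real.norm_of_nonneg (gnpExp_nonneg fun G ↦ by positivity)]
  rw [hnorm, hfinal, norm_mul, norm_mul, norm_inv, Complex.norm_real, Complex.norm_real,
    Real.norm_of_nonneg ha, Real.norm_of_nonneg hn0.le]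
  calc _ ≤ a * n⁻¹ * (n * ((t⁻¹ + 2 * t⁻¹ ^ 2) * (t⁻¹ ^ 2 + 2) +
        (4 * t⁻¹ ^ 3 * (t⁻¹ ^ 2 + 2) + 6 * t⁻¹ ^ 3 * (2 * t⁻¹ + t))) +
        1 * (n * (t⁻¹ * (t⁻¹ ^ 2 + 2))) + 1 * (1 * (n * (t⁻¹ ^ 2 * (t⁻¹ ^ 2 + 2))))) := by
        gcongr
        refine norm_sub_le_of_le (norm_add_le_of_le hY ?_) ?_
        · rw [norm_mul, Complex.norm_real, Real.norm_of_nonneg hp0]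
          gcongr
        · rw [norm_mul, norm_mul, Complex.norm_real, Complex.norm_real,
            Real.norm_of_nonneg hv0, Real.norm_of_nonneg ha]
          gcongr
    _ = _ := by
        rw [defectConst]
        generalize t⁻¹ = τ
        field_simp

end SecondMoment

end SimpleGraph

/-! ### The semicircle law on the imaginary axis. -/

section SemicircleStieltjes

open MeasureTheory Set

/-- The imaginary part of the Stieltjes transform at `t * I` of the semicircle law of
variance `v`. -/
noncomputable def semicircleStieltjes (v t : ℝ) : ℝ := (√(t ^ 2 + 4 * v) - t) / (2 * v)

variable {v t : ℝ}

lemma semicircleStieltjes_eq (hv : 0 < v) (t : ℝ) :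
    v * semicircleStieltjes v t ^ 2 + t * semicircleStieltjes v t = 1 := by
  have h : √(t ^ 2 + 4 * v) ^ 2 = t ^ 2 + 4 * v := Real.sq_sqrt (by positivity)
  rw [semicircleStieltjes]
  generalize √(t ^ 2 + 4 * v) = s at h
  field_simp
  linear_combination h

lemma semicircleStieltjes_pos (hv : 0 < v) (t : ℝ) : 0 < semicircleStieltjes v t := by
  refine div_pos (sub_pos.2 ?_) (by positivity)
  exact Real.lt_sqrt_of_sq_lt (by linarith)

lemma semicircleStieltjes_le_inv (hv : 0 < v) (ht : 0 < t) : semicircleStieltjes v t ≤ t⁻¹ := by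
  rw [← one_div, le_div_iff₀ ht]
  have := semicircleStieltjes_eq hv t
  nlinarith [sq_nonneg (semicircleStieltjes v t)]

/-- An approximate solution of the quadratic equation in the upper half-plane is close to the
Stieltjes transform of the semicircle law. -/
lemma mul_norm_sub_semicircleStieltjes_le (hv : 0 < v) (t : ℝ) {m : ℂ} (hm : 0 ≤ m.im) :
    t * ‖m - semicircleStieltjes v t * Complex.I‖ ≤ ‖v * m ^ 2 + t * Complex.I * m + 1‖ := by
  set y := semicircleStieltjes v t with hy
  have h : (v : ℂ) * y ^ 2 + t * y = 1 := by exact_mod_cast semicircleStieltjes_eq hv t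
  -- The other root, -i(y + t/v), lies in the lower half-plane when t ≥ 0, and for Im m ≥ 0 the
  -- corresponding factor has imaginary part at least t.
  have hfac : (v : ℂ) * m ^ 2 + t * Complex.I * m + 1 =
      (v * m + (v * y + t : ℝ) * Complex.I) * (m - y * Complex.I) := by
    push_cast
    linear_combination (-1 : ℂ) * h + (v * y ^ 2 + t * y : ℂ) * Complex.I_sq
  rw [hfac, norm_mul]
  gcongr
  refine le_trans ?_ (Complex.im_le_norm _)
  have him : ((v : ℂ) * m + (v * y + t : ℝ) * Complex.I).im = v * m.im + (v * y + t) := by simp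
  rw [him]
  have := semicircleStieltjes_pos hv t
  have := mul_nonneg hv.le hm
  have := mul_pos hv (semicircleStieltjes_pos hv t)
  linarith

/-- The quadratic equation gives v y² ≤ 1 and t y ≤ 1, hence also t² v y² ≤ 1 since v ≤ 1. -/
lemma mul_sq_semicircleStieltjes_le (hv : 0 < v) (hv1 : v ≤ 1) (ht : 0 < t) :
    v * semicircleStieltjes v t ^ 2 ≤ 2 / (1 + t ^ 2) := by
  have h := semicircleStieltjes_eq hv t
  have hpos := semicircleStieltjes_pos hv t
  have hle := semicircleStieltjes_le_inv hv ht
  rw [le_div_iff₀ (by positivity)]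
  have h1 : t * semicircleStieltjes v t ≤ 1 := by
    nlinarith [mul_pos hv (pow_pos hpos 2)]
  have h0 : 0 < t * semicircleStieltjes v t := mul_pos ht hpos
  have h2 : (t * semicircleStieltjes v t) ^ 2 ≤ 1 := pow_le_one₀ h0.le h1
  nlinarith

lemma hasDerivAt_semicircleStieltjes (hv : 0 < v) (t : ℝ) :
    HasDerivAt (semicircleStieltjes v)
      ((1 / (2 * √(t ^ 2 + 4 * v)) * (2 * t) - 1) / (2 * v)) t := by
  have h1 : HasDerivAt (fun t : ℝ ↦ t ^ 2 + 4 * v) (2 * t) t := by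
    simpa using (hasDerivAt_pow 2 t).add_const (4 * v)
  have h2 := (Real.hasDerivAt_sqrt (by positivity : t ^ 2 + 4 * v ≠ 0)).comp t h1
  exact (h2.sub (hasDerivAt_id t)).div_const (2 * v)

/-- For t = 1/y - v y one has dt = -(1/y² + v) dy, so v y² dt = -(v + v² y²) dy, a polynomial in y
to integrate. -/
lemma hasDerivAt_semicircle_primitive (hv : 0 < v) (t : ℝ) :
    HasDerivAt (fun t ↦ -v * semicircleStieltjes v t - v ^ 2 / 3 * semicircleStieltjes v t ^ 3)
      (v * semicircleStieltjes v t ^ 2) t := by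
  have h := hasDerivAt_semicircleStieltjes hv t
  have h1 := (h.const_mul (-v)).sub ((h.pow 3).const_mul (v ^ 2 / 3))
  refine h1.congr_deriv ?_
  have hs : 0 < √(t ^ 2 + 4 * v) := Real.sqrt_pos.2 (by positivity)
  have hy : √(t ^ 2 + 4 * v) = t + 2 * v * semicircleStieltjes v t := by
    rw [semicircleStieltjes]
    field_simp
    ring
  have hq := semicircleStieltjes_eq hv t
  rw [hy] at hs ⊢
  generalize semicircleStieltjes v t = y at *
  have hd : (1 / (2 * (t + 2 * v * y)) * (2 * t) - 1) / (2 * v) = -y / (t + 2 * v * y) := by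
    field_simp
    ring
  rw [hd]
  have hs' := hs.ne'
  have hk : y * (1 + v * y ^ 2) = y ^ 2 * (t + 2 * v * y) := by
    linear_combination (-y) * hq
  calc _ = v * (y * (1 + v * y ^ 2) / (t + 2 * v * y)) := by
        push_cast
        ring
    _ = _ := by rw [hk, mul_div_cancel_right₀ _ hs']

lemma continuous_semicircleStieltjes (hv : 0 < v) : Continuous (semicircleStieltjes v) :=
  continuous_iff_continuousAt.2 fun t ↦ (hasDerivAt_semicircleStieltjes hv t).continuousAt

lemma integrableOn_two_div_one_add_sq :
    IntegrableOn (fun t : ℝ ↦ 2 / (1 + t ^ 2)) (Ioi 0) := by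
  simpa [div_eq_mul_inv] using (integrable_inv_one_add_sq.const_mul 2).integrableOn

lemma integrableOn_mul_sq_semicircleStieltjes (hv : 0 < v) (hv1 : v ≤ 1) :
    IntegrableOn (fun t ↦ v * semicircleStieltjes v t ^ 2) (Ioi 0) := by
  refine integrableOn_two_div_one_add_sq.mono'
    ((continuous_semicircleStieltjes hv).pow 2 |>.const_mul v).aestronglyMeasurable ?_
  refine (ae_restrict_iff' measurableSet_Ioi).2 (ae_of_all _ fun t ht ↦ ?_)
  rw [Real.norm_of_nonneg (by positivity)]
  exact mul_sq_semicircleStieltjes_le hv hv1 ht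

lemma tendsto_semicircleStieltjes_atTop (hv : 0 < v) :
    Tendsto (semicircleStieltjes v) atTop (𝓝 0) :=
  squeeze_zero' (Eventually.of_forall fun t ↦ (semicircleStieltjes_pos hv t).le)
    ((eventually_gt_atTop 0).mono fun _ ht ↦ semicircleStieltjes_le_inv hv ht)
    tendsto_inv_atTop_zero

lemma integral_mul_sq_semicircleStieltjes (hv : 0 < v) (hv1 : v ≤ 1) :
    ∫ t in Ioi 0, v * semicircleStieltjes v t ^ 2 = 4 / 3 * √v := by
  have hlim : Tendsto (fun t ↦ -v * semicircleStieltjes v t -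
      v ^ 2 / 3 * semicircleStieltjes v t ^ 3) atTop (𝓝 0) := by
    have h := tendsto_semicircleStieltjes_atTop hv
    simpa using (h.const_mul (-v)).sub ((h.pow 3).const_mul (v ^ 2 / 3))
  rw [integral_Ioi_of_hasDerivAt_of_tendsto' (fun t _ ↦ hasDerivAt_semicircle_primitive hv t)
    (integrableOn_mul_sq_semicircleStieltjes hv hv1) hlim]
  -- The primitive vanishes at infinity, so only its value at t = 0 contributes.
  have h0 : semicircleStieltjes v 0 = √v / v := by
    have : (0 : ℝ) ^ 2 + 4 * v = 2 ^ 2 * v := by ring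
    rw [semicircleStieltjes, this, Real.sqrt_mul (by positivity), Real.sqrt_sq (by positivity)]
    field_simp
    ring
  rw [h0]
  have hs : √v ^ 2 = v := Real.sq_sqrt hv.le
  field_simp
  rw [hs]
  ring

end SemicircleStieltjes

/-! ### Coulson's integral for the absolute value. -/

section AbsIntegral

open MeasureTheory Set

/-- The majorant is integrable in t and depends on x only through x², so summing over eigenvalues
requires only tr A². -/
lemma sq_div_sq_add_sq_le (x t : ℝ) : x ^ 2 / (x ^ 2 + t ^ 2) ≤ (1 + x ^ 2) / (1 + t ^ 2) := by
  rcases (by positivity : 0 ≤ x ^ 2 + t ^ 2).eq_or_lt with h | h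
  · rw [← h, div_zero]
    positivity
  · rw [div_le_div_iff₀ h (by positivity)]
    nlinarith [sq_nonneg t, sq_nonneg (x ^ 2)]

lemma integrableOn_sq_div_sq_add_sq (x : ℝ) :
    IntegrableOn (fun t : ℝ ↦ x ^ 2 / (x ^ 2 + t ^ 2)) (Ioi 0) := by
  refine Integrable.mono' ((integrable_inv_one_add_sq.const_mul (1 + x ^ 2)).integrableOn)
    (Measurable.aestronglyMeasurable (by fun_prop)) (ae_of_all _ fun t ↦ ?_)
  rw [Real.norm_of_nonneg (by positivity), ← div_eq_mul_inv]
  exact sq_div_sq_add_sq_le x t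

/-- The integral formula for the absolute value behind Coulson's formula. -/
lemma integral_sq_div_sq_add_sq (x : ℝ) :
    ∫ t in Ioi 0, x ^ 2 / (x ^ 2 + t ^ 2) = Real.pi / 2 * |x| := by
  rcases eq_or_ne x 0 with rfl | hx
  · simp
  have hx' : 0 < |x| := abs_pos.2 hx
  have h := integral_comp_mul_left_Ioi' (fun t : ℝ ↦ x ^ 2 / (x ^ 2 + t ^ 2)) 0 hx'
  rw [mul_zero] at h
  rw [← h]
  have he (t : ℝ) : x ^ 2 / (x ^ 2 + (|x| * t) ^ 2) = (1 + t ^ 2)⁻¹ := by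
    rw [mul_pow, sq_abs]
    field_simp
  simp only [he]
  rw [integral_Ioi_inv_one_add_sq, Real.arctan_zero, sub_zero, smul_eq_mul, mul_comm]

end AbsIntegral

/-! ### The energy as an integral of resolvent traces. -/

namespace SimpleGraph

open MeasureTheory Matrix

section Energy

variable {V : Type*} [Fintype V] [DecidableEq V]

open scoped Classical in
/-- The eigenvalues of the adjacency matrix. -/
noncomputable def adjEigenvalues (G : SimpleGraph V) : V → ℝ :=
  (G.isHermitian_adjMatrix (R := ℝ)).eigenvalues

lemma graphEnergy_eq (G : SimpleGraph V) : G.graphEnergy = ∑ i, |G.adjEigenvalues i| := rfl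

/-- The left side is tr A², the number of ordered adjacent pairs. -/
lemma sum_sq_adjEigenvalues_le (G : SimpleGraph V) :
    ∑ i, G.adjEigenvalues i ^ 2 ≤ (Fintype.card V : ℝ) ^ 2 := by
  classical
  have hM := G.isHermitian_adjMatrix (R := ℝ)
  have h1 : (G.adjMatrix ℝ * G.adjMatrix ℝ).trace = ∑ i, hM.eigenvalues i ^ 2 := by
    conv_lhs => rw [hM.spectral_theorem, ← map_mul, Unitary.conjStarAlgAut_apply, trace_mul_comm,
      ← mul_assoc, Unitary.coe_star_mul_self, one_mul, diagonal_mul_diagonal, trace_diagonal]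
    simp [sq]
  have h2 : ∑ i, G.adjEigenvalues i ^ 2 = (G.adjMatrix ℝ * G.adjMatrix ℝ).trace := by
    rw [h1, adjEigenvalues]
  rw [h2]
  calc (G.adjMatrix ℝ * G.adjMatrix ℝ).trace ≤ ∑ _i : V, ∑ _j : V, (1 : ℝ) := by
        simp only [trace, diag_apply, Matrix.mul_apply, adjMatrix_apply]
        refine Finset.sum_le_sum fun i _ ↦ Finset.sum_le_sum fun j _ ↦ ?_
        split_ifs <;> norm_num
    _ = _ := by simp [sq]

variable {a t : ℝ}

/-- The normalised spectral sum `(1/n) ∑ μ² / (μ² + t²)` over the eigenvalues `μ` of the scaled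
adjacency matrix. -/
noncomputable def coulsonSum (a t : ℝ) (G : SimpleGraph V) : ℝ :=
  (Fintype.card V : ℝ)⁻¹ *
    ∑ i, (a * G.adjEigenvalues i) ^ 2 / ((a * G.adjEigenvalues i) ^ 2 + t ^ 2)

lemma graphStieltjes_im (ht : 0 < t) (G : SimpleGraph V) :
    (graphStieltjes a t G).im = (Fintype.card V : ℝ)⁻¹ *
      ∑ i, t / ((a * G.adjEigenvalues i) ^ 2 + t ^ 2) := by
  classical
  have h : (graphResolvent a t G).trace =
      ∑ i, (((a * G.adjEigenvalues i : ℝ) : ℂ) - t * Complex.I)⁻¹ :=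
    IsHermitian.trace_imResolvent_smul _ a ht.ne'
  rw [graphStieltjes, ← Complex.ofReal_natCast, ← Complex.ofReal_inv, Complex.im_ofReal_mul, h,
    Complex.im_sum]
  congr 1
  refine Finset.sum_congr rfl fun i _ ↦ ?_
  rw [Complex.inv_im, Complex.normSq_apply]
  simp only [Complex.sub_re, Complex.sub_im, Complex.ofReal_re, Complex.ofReal_im, Complex.mul_re,
    Complex.mul_im, Complex.I_re, Complex.I_im]
  ring_nf

lemma graphStieltjes_im_nonneg (ht : 0 < t) (G : SimpleGraph V) :
    0 ≤ (graphStieltjes a t G).im := by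
  rw [graphStieltjes_im ht]
  positivity

lemma coulsonSum_eq [Nonempty V] (ht : 0 < t) (G : SimpleGraph V) :
    coulsonSum a t G = 1 - t * (graphStieltjes a t G).im := by
  have hn : (Fintype.card V : ℝ) ≠ 0 := by exact_mod_cast Fintype.card_ne_zero
  have h (i : V) : (a * G.adjEigenvalues i) ^ 2 / ((a * G.adjEigenvalues i) ^ 2 + t ^ 2) =
      1 - t * (t / ((a * G.adjEigenvalues i) ^ 2 + t ^ 2)) := by
    have : (a * G.adjEigenvalues i) ^ 2 + t ^ 2 ≠ 0 := by positivity
    field_simp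
    ring
  rw [graphStieltjes_im ht, coulsonSum]
  simp only [h, Finset.sum_sub_distrib, ← Finset.mul_sum]
  simp only [Finset.sum_const, Finset.card_univ, nsmul_eq_mul, mul_one, mul_sub]
  rw [inv_mul_cancel₀ hn]
  ring

lemma coulsonSum_nonneg (G : SimpleGraph V) : 0 ≤ coulsonSum a t G := by
  rw [coulsonSum]
  positivity

/-- A deterministic majorant, uniform in n, for dominated convergence; its numerator is 1 + a² n. -/
lemma coulsonSum_le [Nonempty V] (hn : a ^ 2 * Fintype.card V = 1) (t : ℝ) (G : SimpleGraph V) :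
    coulsonSum a t G ≤ 2 / (1 + t ^ 2) := by
  have hn0 : (0 : ℝ) < Fintype.card V := by exact_mod_cast Fintype.card_pos
  calc coulsonSum a t G ≤ (Fintype.card V : ℝ)⁻¹ *
        ∑ i, (1 + (a * G.adjEigenvalues i) ^ 2) / (1 + t ^ 2) := by
        rw [coulsonSum]
        exact mul_le_mul_of_nonneg_left
          (Finset.sum_le_sum fun i _ ↦ sq_div_sq_add_sq_le _ _) (by positivity)
    _ = (Fintype.card V : ℝ)⁻¹ * ((Fintype.card V + a ^ 2 * ∑ i, G.adjEigenvalues i ^ 2) /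
        (1 + t ^ 2)) := by
        rw [← Finset.sum_div, Finset.sum_add_distrib]
        simp [mul_pow, Finset.mul_sum]
    _ ≤ (Fintype.card V : ℝ)⁻¹ * ((Fintype.card V + a ^ 2 * (Fintype.card V : ℝ) ^ 2) /
        (1 + t ^ 2)) := by
        gcongr
        exact sum_sq_adjEigenvalues_le G
    _ = _ := by
        have : a ^ 2 * (Fintype.card V : ℝ) ^ 2 = Fintype.card V := by
          rw [sq (Fintype.card V : ℝ), ← mul_assoc, hn, one_mul]
        rw [this]
        field_simp
        ring

lemma integrableOn_coulsonSum (G : SimpleGraph V) :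
    IntegrableOn (fun t ↦ coulsonSum a t G) (Set.Ioi 0) :=
  (integrable_finsetSum _ fun _ _ ↦ integrableOn_sq_div_sq_add_sq _).const_mul _

lemma integral_coulsonSum (ha : 0 ≤ a) (G : SimpleGraph V) :
    ∫ t in Set.Ioi 0, coulsonSum a t G =
      Real.pi / 2 * ((Fintype.card V : ℝ)⁻¹ * a * G.graphEnergy) := by
  simp only [coulsonSum]
  rw [integral_const_mul, integral_finsetSum _ fun _ _ ↦ integrableOn_sq_div_sq_add_sq _]
  simp only [integral_sq_div_sq_add_sq, abs_mul, abs_of_nonneg ha, ← Finset.mul_sum]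
  rw [graphEnergy_eq]
  ring

variable {p : unitInterval} {v : ℝ}

/-- The difference is -t Im(s - iy); its factor t absorbs the 1/t lost in the stability bound,
leaving |Q|, whose mean is bounded by Jensen. -/
lemma gnpExp_abs_coulsonSum_sub_le [Nonempty V] (ha : 0 ≤ a) (ha1 : a ≤ 1)
    (hn : a ^ 2 * Fintype.card V = 1) (ht : 0 < t) (hv : v = (p : ℝ) * (1 - p)) (hv0 : 0 < v) :
    gnpExp p (fun G : SimpleGraph V ↦ |coulsonSum a t G - v * semicircleStieltjes v t ^ 2|) ≤
      √(defectConst t * a) := by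
  have h (G : SimpleGraph V) :
      |coulsonSum a t G - v * semicircleStieltjes v t ^ 2| ≤ ‖quadDefect v a t G‖ := by
    have h1 := mul_norm_sub_semicircleStieltjes_le hv0 t (graphStieltjes_im_nonneg (a := a) ht G)
    have h2 := Complex.abs_im_le_norm
      (graphStieltjes a t G - semicircleStieltjes v t * Complex.I)
    have h3 : coulsonSum a t G - v * semicircleStieltjes v t ^ 2 =
        -(t * (graphStieltjes a t G - semicircleStieltjes v t * Complex.I).im) := by
      rw [coulsonSum_eq ht]
      simp
      linear_combination -semicircleStieltjes_eq hv0 t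
    rw [h3, abs_neg, abs_mul, abs_of_pos ht]
    exact (mul_le_mul_of_nonneg_left h2 ht.le).trans h1
  refine (gnpExp_mono h).trans (Real.le_sqrt_of_sq_le ?_)
  exact (sq_gnpExp_le _).trans (gnpExp_sq_norm_quadDefect_le ha ha1 hn ht hv)

lemma abs_coulsonSum_sub_le [Nonempty V] (hn : a ^ 2 * Fintype.card V = 1) (ht : 0 < t)
    (hv0 : 0 < v) (hv1 : v ≤ 1) (G : SimpleGraph V) :
    |coulsonSum a t G - v * semicircleStieltjes v t ^ 2| ≤ 2 / (1 + t ^ 2) := by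
  have h1 := coulsonSum_le hn t G
  have h2 := coulsonSum_nonneg (a := a) (t := t) G
  have h3 := mul_sq_semicircleStieltjes_le hv0 hv1 ht
  have h4 : 0 ≤ v * semicircleStieltjes v t ^ 2 := by positivity
  rw [abs_le]
  constructor <;> linarith

lemma integrableOn_abs_coulsonSum_sub (hv0 : 0 < v) (hv1 : v ≤ 1) (G : SimpleGraph V) :
    IntegrableOn (fun t ↦ |coulsonSum a t G - v * semicircleStieltjes v t ^ 2|) (Set.Ioi 0) :=
  ((integrableOn_coulsonSum G).sub (integrableOn_mul_sq_semicircleStieltjes hv0 hv1)).abs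

lemma abs_energy_sub_le (ha : 0 ≤ a) (hv0 : 0 < v) (hv1 : v ≤ 1) (G : SimpleGraph V) :
    |(Fintype.card V : ℝ)⁻¹ * a * G.graphEnergy - 8 / (3 * Real.pi) * √v| ≤
      2 / Real.pi * ∫ t in Set.Ioi 0, |coulsonSum a t G - v * semicircleStieltjes v t ^ 2| := by
  have hpi := Real.pi_pos
  have h : (Fintype.card V : ℝ)⁻¹ * a * G.graphEnergy - 8 / (3 * Real.pi) * √v =
      2 / Real.pi * ∫ t in Set.Ioi 0, (coulsonSum a t G - v * semicircleStieltjes v t ^ 2) := by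
    rw [integral_sub (integrableOn_coulsonSum G) (integrableOn_mul_sq_semicircleStieltjes hv0 hv1),
      integral_coulsonSum ha, integral_mul_sq_semicircleStieltjes hv0 hv1]
    field_simp
    ring
  rw [h, abs_mul, abs_of_pos (by positivity)]
  gcongr
  exact abs_integral_le_integral_abs

lemma gnpExp_integral {f : ℝ → SimpleGraph V → ℝ} {s : Set ℝ}
    (hf : ∀ G, IntegrableOn (fun t ↦ f t G) s) :
    gnpExp p (fun G ↦ ∫ t in s, f t G) = ∫ t in s, gnpExp p (f t) := by
  simp only [gnpExp, smul_eq_mul]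
  rw [integral_finsetSum _ fun G _ ↦ (hf G).const_mul _]
  simp only [integral_const_mul]

lemma gnpExp_abs_energy_sub_le (ha : 0 ≤ a) (hv0 : 0 < v) (hv1 : v ≤ 1) :
    gnpExp p (fun G : SimpleGraph V ↦
      |(Fintype.card V : ℝ)⁻¹ * a * G.graphEnergy - 8 / (3 * Real.pi) * √v|) ≤
      2 / Real.pi * ∫ t in Set.Ioi 0, gnpExp p (fun G : SimpleGraph V ↦
        |coulsonSum a t G - v * semicircleStieltjes v t ^ 2|) := by
  refine (gnpExp_mono fun G ↦ abs_energy_sub_le ha hv0 hv1 G).trans ?_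
  simp only [← smul_eq_mul (2 / Real.pi)]
  rw [gnpExp_smul, gnpExp_integral fun G ↦ integrableOn_abs_coulsonSum_sub hv0 hv1 G]

end Energy

/-! ### Passage to the limit and concentration. -/

section Limit

variable {p : unitInterval} {v : ℝ}

/-- The normalisation `1 / √n` of the adjacency matrix of a graph on `n` vertices. -/
noncomputable def wignerScale (n : ℕ) : ℝ := (√n)⁻¹

lemma wignerScale_nonneg (n : ℕ) : 0 ≤ wignerScale n := by
  rw [wignerScale]
  positivity

lemma wignerScale_le_one {n : ℕ} (hn : 0 < n) : wignerScale n ≤ 1 :=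
  inv_le_one_of_one_le₀ (Real.one_le_sqrt.2 (by exact_mod_cast hn))

lemma wignerScale_sq_mul {n : ℕ} (hn : 0 < n) :
    wignerScale n ^ 2 * Fintype.card (Fin n) = 1 := by
  rw [wignerScale, inv_pow, Real.sq_sqrt (by positivity), Fintype.card_fin]
  exact inv_mul_cancel₀ (by positivity)

lemma tendsto_wignerScale : Tendsto wignerScale atTop (𝓝 0) :=
  (Real.tendsto_sqrt_atTop.comp tendsto_natCast_atTop_atTop).inv_tendsto_atTop

/-- The mean square bound is not uniform in t, as `defectConst` blows up at 0; it serves only for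
pointwise convergence, and the deterministic majorant does the rest. -/
lemma tendsto_integral_gnpExp_abs_coulsonSum_sub (hv : v = (p : ℝ) * (1 - p)) (hv0 : 0 < v)
    (hv1 : v ≤ 1) :
    Tendsto (fun n : ℕ ↦ ∫ t in Set.Ioi 0, gnpExp p (fun G : SimpleGraph (Fin n) ↦
      |coulsonSum (wignerScale n) t G - v * semicircleStieltjes v t ^ 2|)) atTop (𝓝 0) := by
  rw [show 𝓝 (0 : ℝ) = 𝓝 (∫ _t in Set.Ioi (0 : ℝ), (0 : ℝ)) by simp]
  refine tendsto_integral_filter_of_dominated_convergence (fun t : ℝ ↦ 2 / (1 + t ^ 2))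
    (Eventually.of_forall fun n ↦ ?_) ?_ integrableOn_two_div_one_add_sq ?_
  · exact (integrable_finsetSum _ fun G _ ↦
      (integrableOn_abs_coulsonSum_sub hv0 hv1 G).const_mul _).aestronglyMeasurable
  · filter_upwards [eventually_gt_atTop 0] with n hn
    refine (ae_restrict_iff' measurableSet_Ioi).2 (ae_of_all _ fun t ht ↦ ?_)
    have : Nonempty (Fin n) := ⟨⟨0, hn⟩⟩
    rw [Real.norm_of_nonneg (gnpExp_nonneg fun G ↦ abs_nonneg _)]
    exact (gnpExp_mono fun G ↦
      abs_coulsonSum_sub_le (wignerScale_sq_mul hn) ht hv0 hv1 G).trans (gnpExp_const _).le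
  · refine (ae_restrict_iff' measurableSet_Ioi).2 (ae_of_all _ fun t ht ↦ ?_)
    have hlim : Tendsto (fun n ↦ √(defectConst t * wignerScale n)) atTop (𝓝 0) := by
      simpa using (tendsto_wignerScale.const_mul (defectConst t)).sqrt
    refine squeeze_zero' (Eventually.of_forall fun n ↦ gnpExp_nonneg fun G ↦ abs_nonneg _)
      ?_ hlim
    filter_upwards [eventually_gt_atTop 0] with n hn
    have : Nonempty (Fin n) := ⟨⟨0, hn⟩⟩
    exact gnpExp_abs_coulsonSum_sub_le (wignerScale_nonneg n) (wignerScale_le_one hn)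
      (wignerScale_sq_mul hn) ht hv hv0

/-- The normalised energy converges in mean. -/
theorem tendsto_gnpExp_abs_energy_sub (hv : v = (p : ℝ) * (1 - p)) (hv0 : 0 < v) (hv1 : v ≤ 1) :
    Tendsto (fun n : ℕ ↦ gnpExp p (fun G : SimpleGraph (Fin n) ↦
      |(n : ℝ)⁻¹ * wignerScale n * G.graphEnergy - 8 / (3 * Real.pi) * √v|)) atTop (𝓝 0) := by
  have h := (tendsto_integral_gnpExp_abs_coulsonSum_sub hv hv0 hv1).const_mul (2 / Real.pi)
  rw [mul_zero] at h
  refine squeeze_zero (fun n ↦ gnpExp_nonneg fun G ↦ abs_nonneg _) (fun n ↦ ?_) h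
  simpa only [Fintype.card_fin] using
    gnpExp_abs_energy_sub_le (p := p) (V := Fin n) (wignerScale_nonneg n) hv0 hv1

/-- Convergence in mean implies concentration in a shrinking deterministic window. -/
lemma exists_almostEveryGnp_abs_le {X : (n : ℕ) → SimpleGraph (Fin n) → ℝ}
    (h : Tendsto (fun n ↦ gnpExp p (fun G ↦ |X n G|)) atTop (𝓝 0)) :
    ∃ ε : ℕ → ℝ, Tendsto ε atTop (𝓝 0) ∧ AlmostEveryGnp p (fun n G ↦ |X n G| ≤ ε n) := by
  set D : ℕ → ℝ := fun n ↦ gnpExp p (fun G ↦ |X n G|)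
  -- With ε ≥ √D, Markov's inequality bounds the exceptional probability by D/ε ≤ ε; the term
  -- 1/(n+1) keeps ε positive even if D = 0.
  set ε : ℕ → ℝ := fun n ↦ √(D n) + 1 / ((n : ℝ) + 1)
  have hε : Tendsto ε atTop (𝓝 0) := by
    simpa [ε] using h.sqrt.add tendsto_one_div_add_atTop_nhds_zero_nat
  refine ⟨ε, hε, ?_⟩
  have hlow (n : ℕ) : 1 - ε n ≤ (binomialRandom (Fin n) p).real {G | |X n G| ≤ ε n} := by
    have hD : 0 ≤ D n := gnpExp_nonneg fun G ↦ abs_nonneg _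
    have hpos : 0 < ε n := by positivity
    have hM : ε n * (binomialRandom (Fin n) p).real {G | ε n ≤ |X n G|} ≤ D n :=
      mul_binomialRandom_real_le (fun G ↦ abs_nonneg _) (ε n)
    have hDε : D n ≤ ε n * ε n := by
      have h1 : √(D n) ≤ ε n := le_add_of_nonneg_right (by positivity)
      calc D n = √(D n) * √(D n) := (Real.mul_self_sqrt hD).symm
        _ ≤ _ := by gcongr
    have hM' := le_of_mul_le_mul_left (hM.trans hDε) hpos
    have hun : (Set.univ : Set (SimpleGraph (Fin n))) ⊆
        {G | |X n G| ≤ ε n} ∪ {G | ε n ≤ |X n G|} := fun G _ ↦ le_total |X n G| (ε n)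
    have h1 := (measureReal_mono (μ := binomialRandom (Fin n) p) hun).trans
      (measureReal_union_le _ _)
    rw [probReal_univ] at h1
    linarith
  have hreal : Tendsto (fun n ↦ (binomialRandom (Fin n) p).real {G | |X n G| ≤ ε n}) atTop
      (𝓝 1) := by
    refine tendsto_of_tendsto_of_tendsto_of_le_of_le ?_ tendsto_const_nhds hlow
      fun n ↦ measureReal_le_one
    simpa using hε.const_sub 1
  rw [AlmostEveryGnp]
  have := ENNReal.tendsto_ofReal hreal
  simpa using this

end Limit

end SimpleGraph

/-- The energy of almost every random graph `G_n(p)` is `n^(3/2) (8/(3π) √(p(1-p)) + o(1))`: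
for some deterministic sequence `ε n → 0`, almost every `G` has energy
`n^(3/2) (8/(3π) √(p(1-p)) + δ)` with `|δ| ≤ ε n`. -/
theorem mainTheorem1 (p : unitInterval) (hp0 : 0 < p) (hp1 : p < 1) :
    ∃ ε : ℕ → ℝ, Tendsto ε atTop (𝓝 0) ∧
      SimpleGraph.AlmostEveryGnp p (fun n G ↦
        ∃ δ : ℝ, |δ| ≤ ε n ∧
          G.graphEnergy =
            (n : ℝ) ^ (3 / 2 : ℝ) *
              (8 / (3 * Real.pi) * Real.sqrt ((p : ℝ) * (1 - (p : ℝ))) + δ)) := by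
  have h0 : (0 : ℝ) < p := hp0
  have h1 : (p : ℝ) < 1 := hp1
  have hv0 : 0 < (p : ℝ) * (1 - p) := mul_pos h0 (by linarith)
  have hv1 : (p : ℝ) * (1 - p) ≤ 1 := by nlinarith
  obtain ⟨ε, hε, hae⟩ := SimpleGraph.exists_almostEveryGnp_abs_le
    (SimpleGraph.tendsto_gnpExp_abs_energy_sub rfl hv0 hv1)
  refine ⟨ε, hε, tendsto_of_tendsto_of_tendsto_of_le_of_le' hae tendsto_const_nhds ?_
    (Eventually.of_forall fun n ↦ MeasureTheory.prob_le_one)⟩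
  filter_upwards [eventually_gt_atTop 0] with n hn
  -- The witness δ is the normalised deviation bounded by `hG`; for n > 0 the scaling by n^(3/2) can
  -- be undone.
  refine MeasureTheory.measure_mono fun G hG ↦ ⟨_, hG, ?_⟩
  have hn' : (0 : ℝ) < n := by exact_mod_cast hn
  have hpow : (n : ℝ) ^ (3 / 2 : ℝ) = n * √n := by
    rw [Real.sqrt_eq_rpow, ← Real.rpow_one_add' hn'.le (by norm_num)]
    norm_num
  rw [hpow, SimpleGraph.wignerScale, add_sub_cancel]
  have : √(n : ℝ) ≠ 0 := (Real.sqrt_pos.2 hn').ne'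
  field_simp
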